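/- Let $C\subset\mathbb{R}^2$ be a compact convex set with two perpendicular axes of symmetry $\ell_1$ and $\ell_2$, and put $\mathrm{SymAxis}_i(C)=\ell_i\cap C$ for $i=1,2$. Let $R$ be a maximum area inscribed rectangle (MAIR) of $C$, that is, a non-degenerate rectangle contained in $C$, with sides in arbitrary directions, such that no rectangle contained in $C$ has a larger area. Then: 1. The center of $R$, i.e. the intersection of its diagonals, is the intersection point of $\ell_1$ and $\ell_2$. 2. Unless $R$ has a corner at an end point of $\mathrm{SymAxis}_1(C)$ or of $\mathrm{SymAxis}_2(C)$, for each of the lines $\ell_1$ and $\ell_2$, strictly on each of its two sides there is at least one corner of $R$ that lies on $\partial C$. 3. If $R$ is a square, then either its two diagonals lie on $\mathrm{SymAxis}_1(C)$ and $\mathrm{SymAxis}_2(C)$ (one on each), or each of the four open quadrants cut out by $\ell_1$ and $\ell_2$ contains exactly one corner of $R$. Moreover, at least two diagonally opposite corners of the square lie on $\partial C$. 4. For $i\in\{1,2\}$: if $R$ has two corners (a diagonal) on $\mathrm{SymAxis}_i(C)$, then $R$ is either a square or a rectangle whose longer sides make an angle $\alpha$ with $\pi/6\le\alpha<\pi/4$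 with $\ell_i$. -/

import Mathlib

open scoped InnerProductSpace

noncomputable section

/-- The Euclidean plane. -/
abbrev Plane : Type := EuclideanSpace ℝ (Fin 2)

/-- A (non-degenerate) rectangle in the plane, given by one corner and the two
orthogonal side vectors issuing from it. -/
structure Rectangle where
  base : Plane
  u : Plane
  v : Plane
  u_ne_zero : u ≠ 0
  v_ne_zero : v ≠ 0
  orthogonal : ⟪u, v⟫_ℝ = 0

namespace Rectangle

/-- The four corners, in cyclic order; corners `0, 2` and corners `1, 3` are the two pairs of
diagonally opposite corners. -/
def corner (R : Rectangle) : Fin 4 → Plane :=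
  ![R.base, R.base + R.u, R.base + R.u + R.v, R.base + R.v]

/-- The rectangle as a set of points. -/
def toSet (R : Rectangle) : Set Plane := convexHull ℝ (Set.range R.corner)

/-- The area: the product of the side lengths. -/
def area (R : Rectangle) : ℝ := ‖R.u‖ * ‖R.v‖

/-- The diagonal joining corners `0` and `2`. -/
def diag₁ (R : Rectangle) : Set Plane := segment ℝ (R.corner 0) (R.corner 2)

/-- The diagonal joining corners `1` and `3`. -/
def diag₂ (R : Rectangle) : Set Plane := segment ℝ (R.corner 1) (R.corner 3)

/-- The center, the common midpoint of the two diagonals (see `center_eq`). -/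
def center (R : Rectangle) : Plane := midpoint ℝ (R.corner 0) (R.corner 2)

theorem center_eq (R : Rectangle) : R.center = midpoint ℝ (R.corner 1) (R.corner 3) := by
  simp only [center, corner, midpoint_eq_smul_add, Matrix.cons_val]
  congr 1
  abel

/-- All four sides have the same length. -/
def IsSquare (R : Rectangle) : Prop := ‖R.u‖ = ‖R.v‖

/-- The direction vector of a longer side. -/
def longSide (R : Rectangle) : Plane := if ‖R.v‖ ≤ ‖R.u‖ then R.u else R.v

/-- `R` is a maximum area inscribed rectangle (MAIR) of `C`: it is contained in `C`, and no
rectangle contained in `C`, in any position and orientation, has a larger area. -/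
def IsMAIR (R : Rectangle) (C : Set Plane) : Prop :=
  R.toSet ⊆ C ∧ ∀ R' : Rectangle, R'.toSet ⊆ C → R'.area ≤ R.area

end Rectangle

/-- `ℓ` is a line and `C` is invariant under the reflection in `ℓ`. -/
def IsSymmetryAxis (ℓ : AffineSubspace ℝ Plane) [Nonempty ℓ] (C : Set Plane) : Prop :=
  Module.finrank ℝ ℓ.direction = 1 ∧ EuclideanGeometry.reflection ℓ '' C = C

/-- The part `ℓ ∩ C` of the axis inside `C`. For a compact convex `C` it is a segment, whose
end points are its extreme points. -/
def symAxis (ℓ : AffineSubspace ℝ Plane) (C : Set Plane) : Set Plane := (ℓ : Set Plane) ∩ C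

/-- For `x` outside both lines: the open quadrant, of the four cut out by `ℓ₁` and `ℓ₂`, that
contains `x`. -/
def openQuadrant (ℓ₁ ℓ₂ : AffineSubspace ℝ Plane) (x : Plane) : Set Plane :=
  {y | ℓ₁.SSameSide x y ∧ ℓ₂.SSameSide x y}

/-- The angle in `[0, π / 2]` between the lines spanned by two nonzero vectors. -/
def acuteAngle (v w : Plane) : ℝ :=
  min (InnerProductGeometry.angle v w) (Real.pi - InnerProductGeometry.angle v w)

end

/-! Put the origin at the intersection of the axes. The two reflections compose to the half-turn, so
the translated set `D` is convex and centrally symmetric, and it is enough to compare with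
rectangles centered at the origin.

Center: let the corners be `w ± a ± b`. Averaging with the half-turned copy shows that `±a ± b` lie
in `D` too. If `w ≠ 0` is parallel to a side, the centered rectangle can be stretched along that
side. Otherwise, up to signs of `a` and `b`, the corner `a + b` is interior to `D` while `a - b` may
move along `w` or `-w`; a small similarity (`exists_larger_of_movable`) then yields a larger
centered rectangle. Hence `w = 0` (`IsMaxCentered.offset_eq_zero`).

Boundary: if both `a + b` and `a - b` were interior, a dilation would enlarge the rectangle. So a
diagonally opposite pair of corners lies on the boundary, which gives the second claim and the last
part of the third.

Squares: the half diagonals are orthogonal and equally long, so the corners are quarter turns of one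
another.

Diagonal on an axis: a corner off this axis and its mirror images span a rectangle with sides
parallel to the axes. Comparing areas bounds the squared side ratio by 3
(`IsMaxCentered.sq_norm_le`), which is the angle bound. -/

/-! ### Orthogonal expansions in the plane. -/

theorem plane_inner (x y : Plane) : ⟪x, y⟫_ℝ = x 0 * y 0 + x 1 * y 1 := by
  simp [PiLp.inner_apply, Fin.sum_univ_two, mul_comm]

theorem inner_pos_of_ne_zero {a : Plane} (ha : a ≠ 0) : 0 < ⟪a, a⟫_ℝ :=
  real_inner_self_pos.2 ha

/-- The expansion of a vector in an orthogonal pair of nonzero vectors of the plane. -/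
theorem plane_expansion {a b : Plane} (ha : a ≠ 0) (hb : b ≠ 0) (hab : ⟪a, b⟫_ℝ = 0) (w : Plane) :
    w = (⟪a, w⟫_ℝ / ⟪a, a⟫_ℝ) • a + (⟪b, w⟫_ℝ / ⟪b, b⟫_ℝ) • b := by
  have ha' := inner_pos_of_ne_zero ha
  have hb' := inner_pos_of_ne_zero hb
  simp only [plane_inner] at *
  obtain ⟨k, hk⟩ : ∃ k : ℝ, k * (a 0 * a 0 + a 1 * a 1) = a 0 * b 1 - a 1 * b 0 :=
    -- In the plane `b` must be `k` times the right-angle turn of `a`.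
    ⟨_, div_mul_cancel₀ _ ha'.ne'⟩
  have h0 : b 0 = -(k * a 1) := by
    apply mul_left_cancel₀ ha'.ne'
    linear_combination a 1 * hk + a 0 * hab
  have h1 : b 1 = k * a 0 := by
    apply mul_left_cancel₀ ha'.ne'
    linear_combination -a 0 * hk + a 1 * hab
  have hk0 : k ≠ 0 := by
    rintro rfl
    simp [h0, h1] at hb'
  have hbb : b 0 * b 0 + b 1 * b 1 = k ^ 2 * (a 0 * a 0 + a 1 * a 1) := by
    rw [h0, h1]; ring
  rw [hbb]
  have hne := ha'.ne'
  obtain ⟨N, hN⟩ : ∃ N, N = a 0 * a 0 + a 1 * a 1 := ⟨_, rfl⟩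
  rw [← hN] at hne ⊢
  have key : ∀ i : Fin 2, w i = ((a 0 * w 0 + a 1 * w 1) / N) * a i +
      ((b 0 * w 0 + b 1 * w 1) / (k ^ 2 * N)) * b i := by
    intro i
    fin_cases i
    · simp only [Fin.zero_eta, h0, h1]
      field_simp
      linear_combination w 0 * hN
    · simp only [Fin.mk_one, h0, h1]
      field_simp
      linear_combination w 1 * hN
  ext i
  simpa using key i

/-! ### Enlarging by similarities, and interior points. -/

/-- Rotation by a right angle. -/
def rightAngleTurn (x : Plane) : Plane := !₂[-x 1, x 0]

@[simp] theorem rightAngleTurn_zero_apply (x : Plane) : rightAngleTurn x 0 = -x 1 := rfl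

@[simp] theorem rightAngleTurn_one_apply (x : Plane) : rightAngleTurn x 1 = x 0 := rfl

theorem inner_rightAngleTurn_self (x : Plane) : ⟪x, rightAngleTurn x⟫_ℝ = 0 := by
  simp [plane_inner]; ring

theorem inner_rightAngleTurn_rightAngleTurn (x y : Plane) :
    ⟪rightAngleTurn x, rightAngleTurn y⟫_ℝ = ⟪x, y⟫_ℝ := by
  simp [plane_inner]; ring

theorem rightAngleTurn_ne_zero {x : Plane} (hx : x ≠ 0) : rightAngleTurn x ≠ 0 := by
  rw [← inner_self_ne_zero (𝕜 := ℝ), inner_rightAngleTurn_rightAngleTurn]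
  exact inner_self_ne_zero.2 hx

/-- The image of `x` under the similarity given by multiplication with `α + β i`. -/
def turnScale (α β : ℝ) (x : Plane) : Plane := α • x + β • rightAngleTurn x

theorem inner_turnScale (α β : ℝ) (x y : Plane) :
    ⟪turnScale α β x, turnScale α β y⟫_ℝ = (α ^ 2 + β ^ 2) * ⟪x, y⟫_ℝ := by
  simp [turnScale, plane_inner]; ring

theorem norm_turnScale (α β : ℝ) (x : Plane) :
    ‖turnScale α β x‖ = √(α ^ 2 + β ^ 2) * ‖x‖ := by
  rw [norm_eq_sqrt_real_inner, inner_turnScale, Real.sqrt_mul (by positivity),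
    ← norm_eq_sqrt_real_inner]

theorem turnScale_add (α β : ℝ) (x y : Plane) :
    turnScale α β (x + y) = turnScale α β x + turnScale α β y := by
  ext i; fin_cases i <;> simp [turnScale] <;> ring

theorem turnScale_sub (α β : ℝ) (x y : Plane) :
    turnScale α β (x - y) = turnScale α β x - turnScale α β y := by
  ext i; fin_cases i <;> simp [turnScale] <;> ring

open Filter Topology in
/-- If the corner `a + b` is interior, and the corner `a - b` can be moved without decreasing its
distance from the center, then the rectangle can be turned and enlarged. -/
theorem exists_larger_of_movable {D : Set Plane} (hD : Convex ℝ D) {a b w : Plane} (ha : a ≠ 0)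
    (hb : b ≠ 0) (hab : ⟪a, b⟫_ℝ = 0) (hint : a + b ∈ interior D) (hQ : a - b ∈ D)
    (hQw : a - b + w ∈ D) (hw : w ≠ 0) (hnonneg : 0 ≤ ⟪a - b, w⟫_ℝ) :
    ∃ a' b' : Plane, ⟪a', b'⟫_ℝ = 0 ∧ a' + b' ∈ D ∧ a' - b' ∈ D ∧ ‖a‖ * ‖b‖ < ‖a'‖ * ‖b'‖ := by
  set Q := a - b with hQdef
  have hQ0 : Q ≠ 0 := by
    intro h
    have : ⟪a, Q⟫_ℝ = 0 := by simp [h]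
    rw [hQdef, inner_sub_right, hab, sub_zero] at this
    exact ha (inner_self_eq_zero.1 this)
  have hexp := plane_expansion hQ0 (rightAngleTurn_ne_zero hQ0) (inner_rightAngleTurn_self Q) w
  have hQQ := inner_pos_of_ne_zero hQ0
  set p := ⟪Q, w⟫_ℝ / ⟪Q, Q⟫_ℝ with hp
  set q := ⟪rightAngleTurn Q, w⟫_ℝ / ⟪rightAngleTurn Q, rightAngleTurn Q⟫_ℝ
  have hp0 : 0 ≤ p := div_nonneg hnonneg hQQ.le
  have hcont : Continuous fun t : ℝ => turnScale (1 + t * p) (t * q) (a + b) := by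
    unfold turnScale; fun_prop
  have hev : ∀ᶠ t : ℝ in 𝓝[>] 0, turnScale (1 + t * p) (t * q) (a + b) ∈ D := by
    apply nhdsWithin_le_nhds
    have h0 : turnScale (1 + 0 * p) (0 * q) (a + b) = a + b := by simp [turnScale]
    have := hcont.tendsto 0
    rw [h0] at this
    exact this (mem_interior_iff_mem_nhds.1 hint)
  have hev1 : ∀ᶠ t : ℝ in 𝓝[>] 0, t ∈ Set.Ioo (0 : ℝ) 1 := Ioo_mem_nhdsGT one_pos
  obtain ⟨t, htD, ht0, ht1⟩ := (hev.and hev1).exists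
  refine ⟨turnScale (1 + t * p) (t * q) a, turnScale (1 + t * p) (t * q) b, ?_, ?_, ?_, ?_⟩
  · rw [inner_turnScale, hab, mul_zero]
  · rwa [← turnScale_add]
  · rw [← turnScale_sub, ← hQdef]
    -- With `w = p Q + q i Q`, the multiplier `1 + t (p + q i)` sends `Q` to `Q + t w`, a point
    -- between `Q` and `Q + w`.
    have : turnScale (1 + t * p) (t * q) Q = (1 - t) • Q + t • (Q + w) := by
      conv_rhs => rw [hexp]
      simp only [turnScale]
      module
    rw [this]
    exact hD hQ hQw (by linarith) ht0.le (by ring)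
  · rw [norm_turnScale, norm_turnScale]
    have hr : (1 : ℝ) < (1 + t * p) ^ 2 + (t * q) ^ 2 := by
      have htp : 0 ≤ t * p := mul_nonneg ht0.le hp0
      by_cases hq : q = 0
      · have : p ≠ 0 := by
          intro hp'
          rw [hp', hq] at hexp
          exact hw (by simpa using hexp)
        have : 0 < t * p := mul_pos ht0 (lt_of_le_of_ne hp0 this.symm)
        nlinarith [sq_nonneg (t * q)]
      · have : 0 < (t * q) ^ 2 := by
          have := mul_ne_zero ht0.ne' hq
          positivity
        nlinarith
    have h2 := Real.mul_self_sqrt (zero_le_one.trans hr.le)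
    have hpos : 0 < ‖a‖ * ‖b‖ := by positivity
    nlinarith

/-- The open rectangle with half sides `a` and `b` lies in the interior. -/
theorem mem_interior_of_abs_lt {D : Set Plane} (hD : Convex ℝ D) {a b : Plane} (ha : a ≠ 0)
    (hb : b ≠ 0) (hab : ⟪a, b⟫_ℝ = 0) (h₁ : a + b ∈ D) (h₂ : a - b ∈ D) (h₃ : -a + b ∈ D)
    (h₄ : -a - b ∈ D) {s t : ℝ} (hs : |s| < 1) (ht : |t| < 1) : s • a + t • b ∈ interior D := by
  have ha' := inner_pos_of_ne_zero ha
  have hb' := inner_pos_of_ne_zero hb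
  have hba : ⟪b, a⟫_ℝ = 0 := by rw [real_inner_comm, hab]
  let U : Set Plane := {x | |⟪a, x⟫_ℝ / ⟪a, a⟫_ℝ| < 1 ∧ |⟪b, x⟫_ℝ / ⟪b, b⟫_ℝ| < 1}
  have hU : IsOpen U := by
    apply IsOpen.and <;> exact isOpen_lt (by fun_prop) continuous_const
  have hUD : U ⊆ D := by
    rintro x ⟨hx1, hx2⟩
    rw [plane_expansion ha hb hab x]
    set s := ⟪a, x⟫_ℝ / ⟪a, a⟫_ℝ
    set t := ⟪b, x⟫_ℝ / ⟪b, b⟫_ℝ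
    rw [abs_lt] at hx1 hx2
    have e1 : a + t • b ∈ D := by
      have := hD h₁ h₂ (a := (1 + t) / 2) (b := (1 - t) / 2) (by linarith) (by linarith) (by ring)
      convert this using 1
      module
    have e2 : -a + t • b ∈ D := by
      have := hD h₃ h₄ (a := (1 + t) / 2) (b := (1 - t) / 2) (by linarith) (by linarith) (by ring)
      convert this using 1
      module
    have := hD e1 e2 (a := (1 + s) / 2) (b := (1 - s) / 2) (by linarith) (by linarith) (by ring)
    convert this using 1
    module
  apply interior_maximal hUD hU
  constructor
  · rwa [inner_add_right, inner_smul_right, inner_smul_right, hab, mul_zero, add_zero,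
      mul_div_cancel_right₀ _ ha'.ne']
  · rwa [inner_add_right, inner_smul_right, inner_smul_right, hba, mul_zero, zero_add,
      mul_div_cancel_right₀ _ hb'.ne']

/-! ### Rectangles of maximal area among the centered ones. -/

/-- `a` and `b` are the half sides of a rectangle whose area is maximal among the rectangles in `D`
that are centered at the origin. -/
def IsMaxCentered (D : Set Plane) (a b : Plane) : Prop :=
  ∀ a' b' : Plane, ⟪a', b'⟫_ℝ = 0 → a' + b' ∈ D → a' - b' ∈ D → ‖a'‖ * ‖b'‖ ≤ ‖a‖ * ‖b‖

theorem IsMaxCentered.neg_left {D : Set Plane} {a b : Plane} (h : IsMaxCentered D a b) :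
    IsMaxCentered D (-a) b := by
  simpa [IsMaxCentered] using h

theorem IsMaxCentered.neg_right {D : Set Plane} {a b : Plane} (h : IsMaxCentered D a b) :
    IsMaxCentered D a (-b) := by
  simpa [IsMaxCentered] using h

theorem IsMaxCentered.swap {D : Set Plane} {a b : Plane} (h : IsMaxCentered D a b) :
    IsMaxCentered D b a := by
  simpa [IsMaxCentered, mul_comm ‖b‖] using h

/-- Excludes an offset oblique to the sides: the shift pushes `a + b` into the interior, so the
centered rectangle can be turned and enlarged. -/
theorem IsMaxCentered.not_both_pos {D : Set Plane} (hD : Convex ℝ D) (hneg : ∀ x ∈ D, -x ∈ D)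
    {a b w : Plane} (ha : a ≠ 0) (hb : b ≠ 0) (hab : ⟪a, b⟫_ℝ = 0) (H : IsMaxCentered D a b)
    (h₁ : w + a + b ∈ D) (h₂ : w + a - b ∈ D) (h₃ : w - a + b ∈ D) (h₄ : w - a - b ∈ D)
    (hwa : 0 < ⟪a, w⟫_ℝ) (hwb : 0 < ⟪b, w⟫_ℝ) : False := by
  have mid : ∀ x, w + x ∈ D → w - x ∈ D → x ∈ D := by
    intro x hx hx'
    have := hD hx (hneg _ hx') (a := 1 / 2) (b := 1 / 2) (by norm_num) (by norm_num) (by norm_num)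
    convert this using 1
    module
  have k₁ : a + b ∈ D := mid _ (by convert h₁ using 1; abel) (by convert h₄ using 1; abel)
  have k₂ : a - b ∈ D := mid _ (by convert h₂ using 1; abel) (by convert h₃ using 1; abel)
  have k₃ : -a + b ∈ D := by convert hneg _ k₂ using 1; abel
  have k₄ : -a - b ∈ D := by convert hneg _ k₁ using 1; abel
  have hw0 : w ≠ 0 := by rintro rfl; simp at hwa
  have hexp := plane_expansion ha hb hab w
  have hp : 0 < ⟪a, w⟫_ℝ / ⟪a, a⟫_ℝ := div_pos hwa (inner_pos_of_ne_zero ha)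
  have hq : 0 < ⟪b, w⟫_ℝ / ⟪b, b⟫_ℝ := div_pos hwb (inner_pos_of_ne_zero hb)
  set p := ⟪a, w⟫_ℝ / ⟪a, a⟫_ℝ
  set q := ⟪b, w⟫_ℝ / ⟪b, b⟫_ℝ
  have hint : a + b ∈ interior D := by
    -- Chosen so that `ε p` and `ε q` lie in `(0, 1)`. The point `z = (1 - ε p) a + (1 - ε q) b`
    -- then satisfies `z + ε (w + a + b) = (1 + ε) (a + b)`.
    set ε : ℝ := 1 / (1 + p + q) with hε
    have hε0 : 0 < ε := by positivity
    have hsum : ε + ε * p + ε * q = 1 := by rw [hε]; field_simp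
    have hεp := mul_pos hε0 hp
    have hεq := mul_pos hε0 hq
    have hz : (1 - ε * p) • a + (1 - ε * q) • b ∈ interior D :=
      mem_interior_of_abs_lt hD ha hb hab k₁ k₂ k₃ k₄ (by rw [abs_lt]; constructor <;> linarith)
        (by rw [abs_lt]; constructor <;> linarith)
    apply hD.openSegment_interior_self_subset_interior hz h₁
    refine ⟨1 / (1 + ε), ε / (1 + ε), by positivity, by positivity, by field_simp, ?_⟩
    rw [hexp]
    match_scalars <;> field_simp <;> ring
  have fin : ∀ w', w' ≠ 0 → a - b + w' ∈ D → 0 ≤ ⟪a - b, w'⟫_ℝ → False := by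
    intro w' h1 h2 h3
    obtain ⟨a', b', e1, e2, e3, e4⟩ := exists_larger_of_movable hD ha hb hab hint k₂ h2 h1 h3
    exact absurd (H a' b' e1 e2 e3) (not_le.2 e4)
  -- Both `a - b + w` and `a - b - w` lie in `D`, and one of these moves has nonnegative inner
  -- product with `a - b`.
  rcases le_total 0 ⟪a - b, w⟫_ℝ with h | h
  · exact fin w hw0 (by convert h₂ using 1; abel) h
  · refine fin (-w) (neg_ne_zero.2 hw0) ?_ (by rw [inner_neg_right]; linarith)
    convert hneg _ h₃ using 1
    abel

/-- An offset `w = p a` would let the centered rectangle be stretched along `a` by the factor `1 +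
|p|`. -/
theorem IsMaxCentered.inner_ne_zero {D : Set Plane} (hneg : ∀ x ∈ D, -x ∈ D)
    {a b w : Plane} (ha : a ≠ 0) (hb : b ≠ 0) (hab : ⟪a, b⟫_ℝ = 0) (H : IsMaxCentered D a b)
    (h₁ : w + a + b ∈ D) (h₂ : w + a - b ∈ D) (h₃ : w - a + b ∈ D) (h₄ : w - a - b ∈ D)
    (hw : w ≠ 0) : ⟪b, w⟫_ℝ ≠ 0 := by
  intro hwb
  have hexp := plane_expansion ha hb hab w
  rw [hwb, zero_div, zero_smul, add_zero] at hexp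
  set p := ⟪a, w⟫_ℝ / ⟪a, a⟫_ℝ
  have hp : p ≠ 0 := by
    intro h
    rw [h, zero_smul] at hexp
    exact hw hexp
  have hpos : 0 < ‖a‖ * ‖b‖ := by positivity
  have stretch : ∀ r : ℝ, 1 < r → r • a + b ∈ D → r • a - b ∈ D → False := by
    intro r hr k₁ k₂
    have := H (r • a) b (by rw [real_inner_smul_left, hab, mul_zero]) k₁ k₂
    rw [norm_smul, Real.norm_of_nonneg (by linarith)] at this
    nlinarith
  rcases hp.lt_or_gt with h | h
  · refine stretch (1 - p) (by linarith) ?_ ?_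
    · convert hneg _ h₄ using 1
      rw [hexp]; module
    · convert hneg _ h₃ using 1
      rw [hexp]; module
  · refine stretch (1 + p) (by linarith) ?_ ?_
    · convert h₁ using 1
      rw [hexp]; module
    · convert h₂ using 1
      rw [hexp]; module

/-- A rectangle in a centrally symmetric convex set that is at least as large as all centered
rectangles is centered. -/
theorem IsMaxCentered.offset_eq_zero {D : Set Plane} (hD : Convex ℝ D) (hneg : ∀ x ∈ D, -x ∈ D)
    {a b w : Plane} (ha : a ≠ 0) (hb : b ≠ 0) (hab : ⟪a, b⟫_ℝ = 0) (H : IsMaxCentered D a b)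
    (h₁ : w + a + b ∈ D) (h₂ : w + a - b ∈ D) (h₃ : w - a + b ∈ D) (h₄ : w - a - b ∈ D) :
    w = 0 := by
  by_contra hw
  have hba : ⟪b, a⟫_ℝ = 0 := by rw [real_inner_comm, hab]
  have hwb := H.inner_ne_zero hneg ha hb hab h₁ h₂ h₃ h₄ hw
  have hwa := H.swap.inner_ne_zero (w := w) hneg hb ha hba (by convert h₁ using 1; abel)
    (by convert h₃ using 1; abel) (by convert h₂ using 1; abel) (by convert h₄ using 1; abel) hw
  have ha' := neg_ne_zero.2 ha
  have hb' := neg_ne_zero.2 hb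
  rcases hwa.lt_or_gt with hwa | hwa <;> rcases hwb.lt_or_gt with hwb | hwb
  · exact H.neg_left.neg_right.not_both_pos hD hneg (w := w) ha' hb' (by simpa using hab)
      (by convert h₄ using 1; abel) (by convert h₃ using 1; abel) (by convert h₂ using 1; abel)
      (by convert h₁ using 1; abel) (by simpa using hwa) (by simpa using hwb)
  · exact H.neg_left.not_both_pos hD hneg (w := w) ha' hb (by simpa using hab)
      (by convert h₃ using 1; abel) (by convert h₄ using 1; abel) (by convert h₁ using 1; abel)
      (by convert h₂ using 1; abel) (by simpa using hwa) (by simpa using hwb)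
  · exact H.neg_right.not_both_pos hD hneg (w := w) ha hb' (by simpa using hab)
      (by convert h₂ using 1; abel) (by convert h₁ using 1; abel) (by convert h₄ using 1; abel)
      (by convert h₃ using 1; abel) (by simpa using hwa) (by simpa using hwb)
  · exact H.not_both_pos hD hneg ha hb hab h₁ h₂ h₃ h₄ hwa hwb

open Filter Topology in
/-- A largest centered rectangle has a corner outside of the interior. -/
theorem IsMaxCentered.exists_not_mem_interior {D : Set Plane} {a b : Plane} (ha : a ≠ 0)
    (hb : b ≠ 0) (hab : ⟪a, b⟫_ℝ = 0) (H : IsMaxCentered D a b) :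
    a + b ∉ interior D ∨ a - b ∉ interior D := by
  by_contra! h
  have hev : ∀ x ∈ interior D, ∀ᶠ t : ℝ in 𝓝[>] 1, t • x ∈ D := by
    intro x hx
    apply nhdsWithin_le_nhds
    have hc : Continuous fun t : ℝ => t • x := by fun_prop
    have := hc.tendsto 1
    rw [one_smul] at this
    exact this (mem_interior_iff_mem_nhds.1 hx)
  have hgt : ∀ᶠ t : ℝ in 𝓝[>] 1, 1 < t := self_mem_nhdsWithin
  obtain ⟨t, ⟨h1, h2⟩, ht⟩ := (((hev _ h.1).and (hev _ h.2)).and hgt).exists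
  have := H (t • a) (t • b) (by rw [real_inner_smul_left, real_inner_smul_right, hab]; simp)
    (by rwa [← smul_add]) (by rwa [← smul_sub])
  rw [norm_smul, norm_smul, Real.norm_of_nonneg (by linarith)] at this
  have hpos : 0 < ‖a‖ * ‖b‖ := by positivity
  have ht2 : 1 < t * t := by nlinarith
  nlinarith [mul_lt_mul_of_pos_right ht2 hpos]

/-- A largest centered rectangle with a diagonal on a symmetry axis is not too elongated. -/
theorem IsMaxCentered.sq_norm_le {D : Set Plane} (hneg : ∀ x ∈ D, -x ∈ D) {n : Plane}
    (hn : ‖n‖ = 1) (hrefl : ∀ x ∈ D, x - (2 * ⟪n, x⟫_ℝ) • n ∈ D) {L S : Plane} (hL : L ≠ 0)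
    (hS : S ≠ 0) (hLS : ⟪L, S⟫_ℝ = 0) (H : IsMaxCentered D L S) (hQ : L - S ∈ D)
    (hP : ⟪n, L + S⟫_ℝ = 0) : ‖L‖ ^ 2 ≤ 3 * ‖S‖ ^ 2 := by
  have hn0 : n ≠ 0 := by rintro rfl; simp at hn
  have hnn : ⟪n, n⟫_ℝ = 1 := by rw [real_inner_self_eq_norm_sq, hn]; norm_num
  have hSL : ⟪S, L⟫_ℝ = 0 := by rw [real_inner_comm, hLS]
  have hPP : ⟪L + S, L + S⟫_ℝ = ‖L‖ ^ 2 + ‖S‖ ^ 2 := by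
    simp only [inner_add_left, inner_add_right, hLS, hSL, real_inner_self_eq_norm_sq]; ring
  have hPQ : ⟪L + S, L - S⟫_ℝ = ‖L‖ ^ 2 - ‖S‖ ^ 2 := by
    simp only [inner_add_left, inner_sub_right, hLS, hSL, real_inner_self_eq_norm_sq]; ring
  have hQQ : ⟪L - S, L - S⟫_ℝ = ‖L‖ ^ 2 + ‖S‖ ^ 2 := by
    simp only [inner_sub_left, inner_sub_right, hLS, hSL, real_inner_self_eq_norm_sq]; ring
  have hpos : 0 < ‖L‖ ^ 2 + ‖S‖ ^ 2 := by positivity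
  have hP0 : L + S ≠ 0 := by rw [← inner_self_ne_zero (𝕜 := ℝ), hPP]; exact hpos.ne'
  have hexp := plane_expansion hn0 hP0 hP (L - S)
  rw [hnn, div_one, hPQ, hPP] at hexp
  set c := ⟪n, L - S⟫_ℝ
  set r := (‖L‖ ^ 2 - ‖S‖ ^ 2) / (‖L‖ ^ 2 + ‖S‖ ^ 2) with hr
  have hc : c ^ 2 + r ^ 2 * (‖L‖ ^ 2 + ‖S‖ ^ 2) = ‖L‖ ^ 2 + ‖S‖ ^ 2 := by
    have h := hQQ
    rw [hexp] at h
    have hP' : ⟪L + S, n⟫_ℝ = 0 := by rw [real_inner_comm, hP]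
    rw [inner_add_left, inner_add_right, inner_add_right, real_inner_smul_left,
      real_inner_smul_left, real_inner_smul_left, real_inner_smul_left, real_inner_smul_right,
      real_inner_smul_right, real_inner_smul_right, real_inner_smul_right, hnn, hP, hP', hPP] at h
    linear_combination h
  -- The competitor has the normal and the axial component of `L - S` as half sides; its corners are
  -- `L - S` and its images under the symmetries.
  have hle := H (c • n) (r • (L + S)) (by rw [real_inner_smul_left, real_inner_smul_right, hP]; simp)
    (by rw [← hexp]; exact hQ) (by
      convert hneg _ (hrefl _ hQ) using 1
      change _ = -(L - S - (2 * c) • n)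
      rw [hexp]; module)
  have hsq := pow_le_pow_left₀ (by positivity) hle 2
  have hnP : ‖L + S‖ ^ 2 = ‖L‖ ^ 2 + ‖S‖ ^ 2 := by rw [← real_inner_self_eq_norm_sq, hPP]
  simp only [norm_smul, mul_pow, hn, hnP, Real.norm_eq_abs, sq_abs, mul_one] at hsq
  have hrm : r * (‖L‖ ^ 2 + ‖S‖ ^ 2) = ‖L‖ ^ 2 - ‖S‖ ^ 2 := div_mul_cancel₀ _ hpos.ne'
  have hl : 0 < ‖L‖ ^ 2 := by positivity
  have hs : 0 < ‖S‖ ^ 2 := by positivity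
  generalize ‖L‖ ^ 2 = x at *
  generalize ‖S‖ ^ 2 = y at *
  by_contra! hlt
  have hr1 : 1 / 2 < r := by nlinarith
  -- The squared area comparison thus becomes `4 r² ≤ 1`, where `r = (x - y) / (x + y)`; this is `x
  -- ≤ 3 y`.
  have e : c ^ 2 * (x + y) = 4 * x * y := by
    linear_combination (x + y) * hc - (r * (x + y) + (x - y)) * hrm
  have : 4 * x * y * r ^ 2 ≤ x * y := by
    calc 4 * x * y * r ^ 2 = c ^ 2 * (r ^ 2 * (x + y)) := by rw [← e]; ring
      _ ≤ _ := hsq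
  have hxy : 0 < x * y := mul_pos hl hs
  have hr2 : 1 / 4 < r ^ 2 := by nlinarith
  nlinarith [mul_lt_mul_of_pos_left hr2 hxy]

/-- The axis is parallel to the diagonal `L + S`, so the squared cosine of its angle with `L` is
`‖L‖² / (‖L‖² + ‖S‖²)`, a number in `(1/2, 3/4]`. -/
theorem acuteAngle_mem_Ico {d L S n : Plane} (hn : n ≠ 0) (hL : L ≠ 0) (hd : d ≠ 0)
    (hLS : ⟪L, S⟫_ℝ = 0) (hP : ⟪n, L + S⟫_ℝ = 0) (hnd : ⟪n, d⟫_ℝ = 0) (hlt : ‖S‖ < ‖L‖)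
    (hle : ‖L‖ ^ 2 ≤ 3 * ‖S‖ ^ 2) :
    acuteAngle d L ∈ Set.Ico (Real.pi / 6) (Real.pi / 4) := by
  have hSL : ⟪S, L⟫_ℝ = 0 := by rw [real_inner_comm, hLS]
  have hPP : ⟪L + S, L + S⟫_ℝ = ‖L‖ ^ 2 + ‖S‖ ^ 2 := by
    simp only [inner_add_left, inner_add_right, hLS, hSL, real_inner_self_eq_norm_sq]; ring
  have hl : 0 < ‖L‖ ^ 2 := by positivity
  have hP0 : L + S ≠ 0 := by rw [← inner_self_ne_zero (𝕜 := ℝ), hPP]; positivity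
  have hexp := plane_expansion hn hP0 hP d
  rw [hnd, zero_div, zero_smul, zero_add] at hexp
  set r := ⟪L + S, d⟫_ℝ / ⟪L + S, L + S⟫_ℝ
  have hdL : ⟪d, L⟫_ℝ = r * ‖L‖ ^ 2 := by
    rw [hexp, real_inner_smul_left, inner_add_left, hSL, add_zero, real_inner_self_eq_norm_sq]
  have hdd : ‖d‖ ^ 2 = r ^ 2 * (‖L‖ ^ 2 + ‖S‖ ^ 2) := by
    rw [← hPP, real_inner_self_eq_norm_sq, ← mul_pow]
    conv_lhs => rw [hexp, norm_smul, mul_pow, Real.norm_eq_abs, sq_abs, ← mul_pow]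
  have hdpos : 0 < ‖d‖ ^ 2 := by positivity
  have hcos : Real.cos (InnerProductGeometry.angle d L) ^ 2 * (‖L‖ ^ 2 + ‖S‖ ^ 2) = ‖L‖ ^ 2 := by
    have h := InnerProductGeometry.cos_angle_mul_norm_mul_norm d L
    rw [hdL] at h
    have h2 := congrArg (· ^ 2) h
    simp only [mul_pow] at h2
    rw [hdd] at h2 hdpos
    have hr : r ^ 2 ≠ 0 := by rintro h; rw [h] at hdpos; simp at hdpos
    apply mul_left_cancel₀ (mul_ne_zero hr hl.ne')
    linear_combination h2
  have hlt2 : ‖S‖ ^ 2 < ‖L‖ ^ 2 := by gcongr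
  have hs : 0 ≤ ‖S‖ ^ 2 := by positivity
  have hθ0 := InnerProductGeometry.angle_nonneg d L
  have hθ1 := InnerProductGeometry.angle_le_pi d L
  unfold acuteAngle
  set θ := InnerProductGeometry.angle d L
  have hub : Real.cos θ ^ 2 ≤ 3 / 4 := by nlinarith
  have hlb : 1 / 2 < Real.cos θ ^ 2 := by nlinarith
  have hpi := Real.pi_pos
  have key : ∀ φ, 0 ≤ φ → φ ≤ Real.pi → Real.cos φ ^ 2 ≤ 3 / 4 → Real.pi / 6 ≤ φ := by
    intro φ h0 h1 h2
    by_contra! h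
    have := Real.cos_lt_cos_of_nonneg_of_le_pi h0 (by linarith) h
    rw [Real.cos_pi_div_six] at this
    have h3 : (√3 : ℝ) ^ 2 = 3 := Real.sq_sqrt (by norm_num)
    have h4 : (0 : ℝ) ≤ √3 := Real.sqrt_nonneg 3
    nlinarith
  refine ⟨le_min (key _ hθ0 hθ1 hub) (key _ (by linarith) (by linarith) ?_), ?_⟩
  · rwa [Real.cos_pi_sub, neg_sq]
  · by_contra! h
    obtain ⟨h1, h2⟩ := le_min_iff.1 h
    have c1 := Real.cos_le_cos_of_nonneg_of_le_pi (by positivity) hθ1 h1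
    have c2 := Real.cos_le_cos_of_nonneg_of_le_pi hθ0 (by linarith) (show θ ≤ Real.pi - Real.pi / 4 by linarith)
    rw [Real.cos_pi_sub] at c2
    rw [Real.cos_pi_div_four] at c1 c2
    have h3 : (√2 : ℝ) ^ 2 = 2 := Real.sq_sqrt (by norm_num)
    nlinarith

/-! ### Axes described by a common point and unit normals. -/

theorem exists_unit_mem {U : Submodule ℝ Plane} (h : Module.finrank ℝ U = 1) :
    ∃ e ∈ U, ‖e‖ = 1 := by
  obtain ⟨v, hv, -⟩ := finrank_eq_one_iff'.1 h
  have hv' : (v : Plane) ≠ 0 := by simpa using hv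
  refine ⟨‖(v : Plane)‖⁻¹ • (v : Plane), U.smul_mem _ v.2, ?_⟩
  rw [norm_smul, norm_inv, norm_norm, inv_mul_cancel₀ (norm_ne_zero_iff.2 hv')]

/-- `ℓ` is the line through `o` with normal vector `n`. -/
def HasNormal (ℓ : AffineSubspace ℝ Plane) (o n : Plane) : Prop :=
  ∀ x, x ∈ ℓ ↔ ⟪n, x - o⟫_ℝ = 0

theorem exists_hasNormal {ℓ₁ ℓ₂ : AffineSubspace ℝ Plane} [Nonempty ℓ₁] [Nonempty ℓ₂]
    (h₁ : Module.finrank ℝ ℓ₁.direction = 1) (h₂ : Module.finrank ℝ ℓ₂.direction = 1)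
    (hperp : ℓ₁.direction ⟂ ℓ₂.direction) :
    ∃ o n₁ n₂ : Plane, ‖n₁‖ = 1 ∧ ‖n₂‖ = 1 ∧ ⟪n₁, n₂⟫_ℝ = 0 ∧
      HasNormal ℓ₁ o n₁ ∧ HasNormal ℓ₂ o n₂ := by
  obtain ⟨e₁, he₁, hn₁⟩ := exists_unit_mem h₁
  obtain ⟨e₂, he₂, hn₂⟩ := exists_unit_mem h₂
  have e₁0 : e₁ ≠ 0 := by rintro rfl; simp at hn₁
  have e₂0 : e₂ ≠ 0 := by rintro rfl; simp at hn₂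
  rw [Submodule.isOrtho_iff_inner_eq] at hperp
  have h12 := hperp _ he₁ _ he₂
  have h21 : ⟪e₂, e₁⟫_ℝ = 0 := by rw [real_inner_comm, h12]
  obtain ⟨p₁, hp₁⟩ := ‹Nonempty ℓ₁›
  obtain ⟨p₂, hp₂⟩ := ‹Nonempty ℓ₂›
  -- The intersection point is reached from `p₁` along `e₁` and from `p₂` along `e₂`; each direction
  -- is normal to the other line.
  have hexp := plane_expansion e₁0 e₂0 h12 (p₂ - p₁)
  set s := ⟪e₁, p₂ - p₁⟫_ℝ / ⟪e₁, e₁⟫_ℝ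
  set t := ⟪e₂, p₂ - p₁⟫_ℝ / ⟪e₂, e₂⟫_ℝ
  have ho₁ : p₁ + s • e₁ ∈ ℓ₁ := by
    rw [← AffineSubspace.vsub_right_mem_direction_iff_mem hp₁]
    simpa using ℓ₁.direction.smul_mem s he₁
  have ho₂ : p₁ + s • e₁ ∈ ℓ₂ := by
    have : p₁ + s • e₁ = p₂ - t • e₂ := by
      rw [← sub_add_cancel p₂ p₁, hexp]; module
    rw [this, ← AffineSubspace.vsub_right_mem_direction_iff_mem hp₂]
    simpa using ℓ₂.direction.smul_mem (-t) he₂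
  refine ⟨p₁ + s • e₁, e₂, e₁, hn₂, hn₁, h21, fun x => ?_, fun x => ?_⟩
  · rw [← AffineSubspace.vsub_right_mem_direction_iff_mem ho₁, vsub_eq_sub]
    refine ⟨fun h => by rw [real_inner_comm]; exact hperp _ h _ he₂, fun h => ?_⟩
    rw [plane_expansion e₁0 e₂0 h12 (x - _), h, zero_div, zero_smul, add_zero]
    exact ℓ₁.direction.smul_mem _ he₁
  · rw [← AffineSubspace.vsub_right_mem_direction_iff_mem ho₂, vsub_eq_sub]
    refine ⟨fun h => hperp _ he₁ _ h, fun h => ?_⟩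
    rw [plane_expansion e₁0 e₂0 h12 (x - _), h, zero_div, zero_smul, zero_add]
    exact ℓ₂.direction.smul_mem _ he₂

namespace HasNormal

variable {ℓ : AffineSubspace ℝ Plane} {o n : Plane}

theorem mem_self (h : HasNormal ℓ o n) : o ∈ ℓ := by
  rw [h]; simp

theorem mem_direction (h : HasNormal ℓ o n) (d : Plane) : d ∈ ℓ.direction ↔ ⟪n, d⟫_ℝ = 0 := by
  have := AffineSubspace.vsub_right_mem_direction_iff_mem h.mem_self (o + d)
  rw [h] at this
  simpa using this

theorem foot_mem (h : HasNormal ℓ o n) (hn : ‖n‖ = 1) (x : Plane) :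
    x - ⟪n, x - o⟫_ℝ • n ∈ ℓ := by
  rw [h, sub_right_comm, inner_sub_right, real_inner_smul_right, real_inner_self_eq_norm_sq, hn]
  ring

theorem reflection_mem (h : HasNormal ℓ o n) [Nonempty ℓ] (hn : ‖n‖ = 1) {C : Set Plane}
    (hC : EuclideanGeometry.reflection ℓ '' C = C) {x : Plane} (hx : o + x ∈ C) :
    o + (x - (2 * ⟪n, x⟫_ℝ) • n) ∈ C := by
  have hf := h.foot_mem hn (o + x)
  rw [add_sub_cancel_left] at hf
  have hv : ⟪n, x⟫_ℝ • n ∈ ℓ.directionᗮ := by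
    refine Submodule.smul_mem _ _ ((Submodule.mem_orthogonal' _ _).2 fun d hd => ?_)
    exact (h.mem_direction d).1 hd
  have hr := EuclideanGeometry.reflection_orthogonal_vadd hf hv
  have e : ⟪n, x⟫_ℝ • n +ᵥ (o + x - ⟪n, x⟫_ℝ • n) = o + x := by
    rw [vadd_eq_add]; abel
  rw [e] at hr
  have := hC.subset (Set.mem_image_of_mem _ hx)
  rw [hr, vadd_eq_add] at this
  convert this using 1
  module

theorem sSameSide_iff (h : HasNormal ℓ o n) (hn : ‖n‖ = 1) {x y : Plane} :
    ℓ.SSameSide x y ↔ 0 < ⟪n, x - o⟫_ℝ * ⟪n, y - o⟫_ℝ := by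
  have hne : ∀ x, x ∉ ℓ ↔ ⟪n, x - o⟫_ℝ ≠ 0 := fun x => (h x).not
  constructor
  · rintro ⟨⟨p₁, hp₁, p₂, hp₂, hray⟩, hx, hy⟩
    have hsub : ∀ x p, p ∈ ℓ → ⟪n, x -ᵥ p⟫_ℝ = ⟪n, x - o⟫_ℝ := by
      intro x p hp
      have h1 : x -ᵥ p = (x - o) - (p - o) := by rw [vsub_eq_sub]; abel
      rw [h1, inner_sub_right, (h p).1 hp, sub_zero]
    have hx1 := hsub x p₁ hp₁
    have hy1 := hsub y p₂ hp₂
    rw [hne] at hx hy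
    have hx0 : x -ᵥ p₁ ≠ 0 := by
      intro h0; rw [h0, inner_zero_right] at hx1; exact hx hx1.symm
    have hy0 : y -ᵥ p₂ ≠ 0 := by
      intro h0; rw [h0, inner_zero_right] at hy1; exact hy hy1.symm
    obtain ⟨r, hr, he⟩ := hray.exists_pos_left hx0 hy0
    rw [← he, real_inner_smul_right, hx1] at hy1
    rw [← hy1]
    have := mul_self_pos.2 hx
    nlinarith
  · intro hpos
    refine ⟨⟨_, h.foot_mem hn x, _, h.foot_mem hn y, ?_⟩, ?_, ?_⟩
    · have e : ∀ z c : Plane, z -ᵥ (z - c) = c := fun z c => by simp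
      rw [e, e]
      rcases pos_and_pos_or_neg_and_neg_of_mul_pos hpos with ⟨h1, h2⟩ | ⟨h1, h2⟩
      · exact SameRay.sameRay_nonneg_smul_left _ h1.le |>.nonneg_smul_right h2.le
      · rw [← sameRay_neg_iff, ← neg_smul, ← neg_smul]
        exact SameRay.sameRay_nonneg_smul_left _ (by linarith) |>.nonneg_smul_right (by linarith)
    · rw [hne]; exact left_ne_zero_of_mul hpos.ne'
    · rw [hne]; exact right_ne_zero_of_mul hpos.ne'

/-- A point of an axis outside of the interior is an end point of the axis segment. -/
theorem mem_extremePoints (h : HasNormal ℓ o n) (hn : n ≠ 0) {C : Set Plane} (hC : Convex ℝ C)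
    (ho : o ∈ interior C) {x : Plane} (hxℓ : x ∈ ℓ) (hxC : x ∈ C) (hx : x ∉ interior C) :
    x ∈ (symAxis ℓ C).extremePoints ℝ := by
  have hxo : x - o ≠ 0 := by
    intro h0; rw [sub_eq_zero.1 h0] at hx; exact hx ho
  -- A parameter `r > 1` would put `x` strictly between the interior point `o` and a point of `C`,
  -- making `x` interior.
  have key : ∀ y ∈ symAxis ℓ C, ∃ r : ℝ, r ≤ 1 ∧ y = o + r • (x - o) := by
    rintro y ⟨hyℓ, hyC⟩
    have hexp := plane_expansion hn hxo ((h x).1 hxℓ) (y - o)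
    rw [(h y).1 hyℓ, zero_div, zero_smul, zero_add] at hexp
    set r := ⟪x - o, y - o⟫_ℝ / ⟪x - o, x - o⟫_ℝ
    have hy : y = o + r • (x - o) := by rw [← hexp]; abel
    refine ⟨r, ?_, hy⟩
    by_contra! hr
    refine hx (hC.openSegment_interior_self_subset_interior ho hyC
      ⟨1 - 1 / r, 1 / r, ?_, by positivity, by ring, ?_⟩)
    · rw [sub_pos, div_lt_one (by linarith)]; exact hr
    · rw [hy]
      match_scalars <;> field_simp; ring
  rw [_root_.mem_extremePoints]
  refine ⟨⟨hxℓ, hxC⟩, fun x₁ hx₁ x₂ hx₂ => ?_⟩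
  rintro ⟨α, β, hα, hβ, hαβ, he⟩
  obtain ⟨r₁, h₁, e₁⟩ := key x₁ hx₁
  obtain ⟨r₂, h₂, e₂⟩ := key x₂ hx₂
  have hsum : (α * r₁ + β * r₂ - 1) • (x - o) = 0 := by
    have : x = (α + β) • o + (α * r₁ + β * r₂) • (x - o) := by
      conv_lhs => rw [← he, e₁, e₂]
      module
    rw [hαβ, one_smul] at this
    rw [sub_smul, one_smul, sub_eq_zero]
    exact (sub_eq_of_eq_add' this).symm
  have hs := (smul_eq_zero.1 hsum).resolve_right hxo
  have hr₁ : r₁ = 1 := by nlinarith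
  have hr₂ : r₂ = 1 := by nlinarith
  rw [e₁, e₂, hr₁, hr₂]
  simp

end HasNormal

/-! ### Coordinates of the corners of a square, and angles for either diagonal. -/

theorem inner_eq_of_orthonormal {n₁ n₂ : Plane} (h₁ : ‖n₁‖ = 1) (h₂ : ‖n₂‖ = 1)
    (h₁₂ : ⟪n₁, n₂⟫_ℝ = 0) (x y : Plane) :
    ⟪x, y⟫_ℝ = ⟪n₁, x⟫_ℝ * ⟪n₁, y⟫_ℝ + ⟪n₂, x⟫_ℝ * ⟪n₂, y⟫_ℝ := by
  have e₁ : n₁ ≠ 0 := by rintro rfl; simp at h₁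
  have e₂ : n₂ ≠ 0 := by rintro rfl; simp at h₂
  conv_lhs => rw [plane_expansion e₁ e₂ h₁₂ x]
  rw [inner_add_left, real_inner_smul_left, real_inner_smul_left, real_inner_self_eq_norm_sq,
    real_inner_self_eq_norm_sq, h₁, h₂]
  ring

theorem eq_turn_of_orthogonal {p q p' q' : ℝ} (hq : q ≠ 0) (h : p * p' + q * q' = 0)
    (h' : p * p + q * q = p' * p' + q' * q') : (p' = q ∧ q' = -p) ∨ (p' = -q ∧ q' = p) := by
  have hpos : p * p + q * q ≠ 0 := by
    nlinarith [mul_self_nonneg p, mul_self_pos.2 hq]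
  have hsq : p' ^ 2 = q ^ 2 := by
    apply mul_right_cancel₀ hpos
    linear_combination (p * p' - q * q') * h - q ^ 2 * h'
  rcases sq_eq_sq_iff_eq_or_eq_neg.1 hsq with rfl | rfl
  · exact Or.inl ⟨rfl, mul_left_cancel₀ hq (by linear_combination h)⟩
  · exact Or.inr ⟨rfl, mul_left_cancel₀ hq (by linear_combination h)⟩

/-- The vectors are the successive quarter turns of `(-p, -q)`, so with nonzero coordinates they
visit each quadrant once. The primed version treats the opposite orientation. -/
theorem existsUnique_same_signs {X Y p q : ℝ} (hX : X ≠ 0) (hY : Y ≠ 0) (hp : p ≠ 0)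
    (hq : q ≠ 0) :
    ∃! k : Fin 4, 0 < X * ![-p, q, p, -q] k ∧ 0 < Y * ![-q, -p, q, p] k := by
  rcases hX.lt_or_gt with hX | hX <;> rcases hY.lt_or_gt with hY | hY <;>
    rcases hp.lt_or_gt with hp | hp <;> rcases hq.lt_or_gt with hq | hq <;>
    simp [ExistsUnique, Fin.forall_fin_succ, mul_pos_iff, hX, hY, hp, hq,
      hX.not_gt, hY.not_gt, hp.not_gt, hq.not_gt, -not_and]

theorem existsUnique_same_signs' {X Y p q : ℝ} (hX : X ≠ 0) (hY : Y ≠ 0) (hp : p ≠ 0)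
    (hq : q ≠ 0) :
    ∃! k : Fin 4, 0 < X * ![-p, -q, p, q] k ∧ 0 < Y * ![-q, p, q, -p] k := by
  rcases hX.lt_or_gt with hX | hX <;> rcases hY.lt_or_gt with hY | hY <;>
    rcases hp.lt_or_gt with hp | hp <;> rcases hq.lt_or_gt with hq | hq <;>
    simp [ExistsUnique, Fin.forall_fin_succ, mul_pos_iff, hX, hY, hp, hq,
      hX.not_gt, hY.not_gt, hp.not_gt, hq.not_gt, -not_and]

/-- Replacing `S` by `-S` exchanges the two diagonals. -/
theorem IsMaxCentered.acuteAngle_mem_Ico_of_lt {D : Set Plane} (hneg : ∀ x ∈ D, -x ∈ D)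
    {n L S d : Plane} (hn : ‖n‖ = 1) (hrefl : ∀ x ∈ D, x - (2 * ⟪n, x⟫_ℝ) • n ∈ D)
    (hL : L ≠ 0) (hS : S ≠ 0) (hLS : ⟪L, S⟫_ℝ = 0) (H : IsMaxCentered D L S) (hP : L + S ∈ D)
    (hQ : L - S ∈ D) (hlt : ‖S‖ < ‖L‖) (hd : d ≠ 0) (hnd : ⟪n, d⟫_ℝ = 0)
    (hdiag : ⟪n, L + S⟫_ℝ = 0 ∨ ⟪n, L - S⟫_ℝ = 0) :
    acuteAngle d L ∈ Set.Ico (Real.pi / 6) (Real.pi / 4) := by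
  have hn0 : n ≠ 0 := by rintro rfl; simp at hn
  rcases hdiag with h | h
  · exact acuteAngle_mem_Ico hn0 hL hd hLS h hnd hlt (H.sq_norm_le hneg hn hrefl hL hS hLS hQ h)
  · rw [sub_eq_add_neg] at h
    have hle := H.neg_right.sq_norm_le hneg hn hrefl hL (neg_ne_zero.2 hS) (by simpa using hLS)
      (by simpa using hP) h
    exact acuteAngle_mem_Ico hn0 hL hd (by simpa using hLS) h hnd (by simpa using hlt) hle

theorem acuteAngle_two_smul_right (d x : Plane) : acuteAngle d ((2 : ℝ) • x) = acuteAngle d x := by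
  simp [acuteAngle, InnerProductGeometry.angle_smul_right_of_pos]

/-! ### Rectangles given by center and half sides. -/

namespace Rectangle

theorem toSet_subset_iff (R : Rectangle) {C : Set Plane} (hC : Convex ℝ C) :
    R.toSet ⊆ C ↔ ∀ k, R.corner k ∈ C := by
  rw [toSet, hC.convexHull_subset_iff, Set.range_subset_iff]

/-- The rectangle with center `o` and half sides `a` and `b`. -/
def ofCenter (o a b : Plane) (ha : a ≠ 0) (hb : b ≠ 0) (hab : ⟪a, b⟫_ℝ = 0) : Rectangle where
  base := o - a - b
  u := (2 : ℝ) • a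
  v := (2 : ℝ) • b
  u_ne_zero := by simpa using ha
  v_ne_zero := by simpa using hb
  orthogonal := by rw [real_inner_smul_left, real_inner_smul_right, hab]; simp

theorem exists_eq_ofCenter (R : Rectangle) : ∃ a b ha hb hab,
    R = ofCenter R.center a b ha hb hab := by
  refine ⟨(1 / 2 : ℝ) • R.u, (1 / 2 : ℝ) • R.v, by simpa using R.u_ne_zero,
    by simpa using R.v_ne_zero,
    by rw [real_inner_smul_left, real_inner_smul_right, R.orthogonal]; simp, ?_⟩
  obtain ⟨p, u, v, hu, hv, huv⟩ := R
  simp only [ofCenter, center, corner, midpoint_eq_smul_add, mk.injEq, Matrix.cons_val]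
  refine ⟨?_, ?_, ?_⟩
  · match_scalars <;> norm_num
  · module
  · module

section ofCenter

variable {o a b : Plane} {ha : a ≠ 0} {hb : b ≠ 0} {hab : ⟪a, b⟫_ℝ = 0}

theorem corner_ofCenter : (ofCenter o a b ha hb hab).corner =
    ![o + -(a + b), o + (a - b), o + (a + b), o + -(a - b)] := by
  simp only [corner, ofCenter]
  congr 1
  · abel
  congr 1
  · module
  congr 1
  · module
  congr 1
  module

theorem area_ofCenter : (ofCenter o a b ha hb hab).area = 4 * (‖a‖ * ‖b‖) := by
  simp only [area, ofCenter, norm_smul]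
  norm_num
  ring

theorem isSquare_ofCenter : (ofCenter o a b ha hb hab).IsSquare ↔ ‖a‖ = ‖b‖ := by
  simp [IsSquare, ofCenter, norm_smul]

theorem acuteAngle_longSide_ofCenter (d : Plane) :
    acuteAngle d (ofCenter o a b ha hb hab).longSide =
      acuteAngle d (if ‖b‖ ≤ ‖a‖ then a else b) := by
  have : (ofCenter o a b ha hb hab).longSide = (2 : ℝ) • (if ‖b‖ ≤ ‖a‖ then a else b) := by
    simp [longSide, ofCenter, norm_smul]
  rw [this, acuteAngle_two_smul_right]

/-- The center `c` is not yet known to be `o`, so maximality is transferred to competitors centered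
at `o`; degenerate ones have area zero. -/
theorem isMaxCentered_of_isMAIR {C : Set Plane} (hC : Convex ℝ C) {c : Plane}
    (hR : (ofCenter c a b ha hb hab).IsMAIR C) (hneg : ∀ x, o + x ∈ C → o + -x ∈ C) :
    IsMaxCentered {x | o + x ∈ C} a b := by
  intro a' b' hab' h₁ h₂
  by_cases ha' : a' = 0
  · rw [ha', norm_zero, zero_mul]; positivity
  by_cases hb' : b' = 0
  · rw [hb', norm_zero, mul_zero]; positivity
  have := hR.2 (ofCenter o a' b' ha' hb' hab') (by
    rw [toSet_subset_iff _ hC, corner_ofCenter]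
    simp only [Fin.forall_fin_succ, IsEmpty.forall_iff, Matrix.cons_val]
    exact ⟨hneg _ h₁, h₂, h₁, hneg _ h₂, trivial⟩)
  rw [area_ofCenter, area_ofCenter] at this
  linarith

end ofCenter

end Rectangle

/-! ### The main theorem. -/

theorem mem_interior_preimage_add {C : Set Plane} {o x : Plane} :
    x ∈ interior {x | o + x ∈ C} ↔ o + x ∈ interior C := by
  have := (Homeomorph.addLeft o).preimage_interior C
  exact (Set.ext_iff.1 this x).symm

open Rectangle in
theorem mainTheorem4 (C : Set Plane) (hCcompact : IsCompact C) (hCconvex : Convex ℝ C)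
    (ℓ₁ ℓ₂ : AffineSubspace ℝ Plane) [Nonempty ℓ₁] [Nonempty ℓ₂]
    (h₁ : IsSymmetryAxis ℓ₁ C) (h₂ : IsSymmetryAxis ℓ₂ C)
    (hperp : ℓ₁.direction ⟂ ℓ₂.direction)
    (R : Rectangle) (hR : R.IsMAIR C) :
    -- the center of `R` is the intersection point of the axes
    ((ℓ₁ : Set Plane) ∩ (ℓ₂ : Set Plane) = {R.center}) ∧
    -- unless a corner is an end point of an axis segment, each side of each axis contains
    -- a corner that lies on the boundary
    ((¬ ∃ k, R.corner k ∈ (symAxis ℓ₁ C).extremePoints ℝ ∪ (symAxis ℓ₂ C).extremePoints ℝ) →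
      (∀ x, x ∉ ℓ₁ → ∃ k, ℓ₁.SSameSide x (R.corner k) ∧ R.corner k ∈ frontier C) ∧
      (∀ x, x ∉ ℓ₂ → ∃ k, ℓ₂.SSameSide x (R.corner k) ∧ R.corner k ∈ frontier C)) ∧
    -- squares
    (R.IsSquare →
      (((R.diag₁ ⊆ symAxis ℓ₁ C ∧ R.diag₂ ⊆ symAxis ℓ₂ C) ∨
          (R.diag₁ ⊆ symAxis ℓ₂ C ∧ R.diag₂ ⊆ symAxis ℓ₁ C)) ∨
        (∀ x, x ∉ ℓ₁ → x ∉ ℓ₂ → ∃! k, R.corner k ∈ openQuadrant ℓ₁ ℓ₂ x)) ∧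
      ((R.corner 0 ∈ frontier C ∧ R.corner 2 ∈ frontier C) ∨
        (R.corner 1 ∈ frontier C ∧ R.corner 3 ∈ frontier C))) ∧
    -- two corners on the same axis segment
    (∀ ℓ : AffineSubspace ℝ Plane, (ℓ = ℓ₁ ∨ ℓ = ℓ₂) →
      (∃ j k, j ≠ k ∧ R.corner j ∈ symAxis ℓ C ∧ R.corner k ∈ symAxis ℓ C) →
      R.IsSquare ∨
        ∀ d ∈ ℓ.direction, d ≠ 0 →
          acuteAngle d R.longSide ∈ Set.Ico (Real.pi / 6) (Real.pi / 4)) := by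
  obtain ⟨o, n₁, n₂, hn₁, hn₂, hn₁₂, hℓ₁, hℓ₂⟩ := exists_hasNormal h₁.1 h₂.1 hperp
  have n₁0 : n₁ ≠ 0 := by rintro rfl; simp at hn₁
  have n₂0 : n₂ ≠ 0 := by rintro rfl; simp at hn₂
  have hcoord := inner_eq_of_orthonormal hn₁ hn₂ hn₁₂
  have hrefl₁ : ∀ x ∈ {x | o + x ∈ C}, x - (2 * ⟪n₁, x⟫_ℝ) • n₁ ∈ {x | o + x ∈ C} :=
    fun x hx => hℓ₁.reflection_mem hn₁ h₁.2 hx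
  have hrefl₂ : ∀ x ∈ {x | o + x ∈ C}, x - (2 * ⟪n₂, x⟫_ℝ) • n₂ ∈ {x | o + x ∈ C} :=
    fun x hx => hℓ₂.reflection_mem hn₂ h₂.2 hx
  -- Reflections in perpendicular lines compose to the half-turn about their intersection.
  have hneg : ∀ x ∈ {x | o + x ∈ C}, -x ∈ {x | o + x ∈ C} := by
    intro x hx
    convert hrefl₂ _ (hrefl₁ x hx) using 1
    have hexp := plane_expansion n₁0 n₂0 hn₁₂ x
    rw [real_inner_self_eq_norm_sq, real_inner_self_eq_norm_sq, hn₁, hn₂, one_pow, div_one,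
      div_one] at hexp
    rw [inner_sub_right, real_inner_smul_right, real_inner_comm n₁ n₂, hn₁₂, mul_zero, sub_zero]
    have e : x - (2 * ⟪n₁, x⟫_ℝ) • n₁ - (2 * ⟪n₂, x⟫_ℝ) • n₂ =
        x - (2 : ℝ) • (⟪n₁, x⟫_ℝ • n₁ + ⟪n₂, x⟫_ℝ • n₂) := by module
    rw [e, ← hexp]
    module
  have hD : Convex ℝ {x | o + x ∈ C} := hCconvex.translate_preimage_right o
  obtain ⟨a, b, ha, hb, hab, hRab⟩ := R.exists_eq_ofCenter
  generalize R.center = c at hRab ⊢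
  subst hRab
  have H := isMaxCentered_of_isMAIR hCconvex hR hneg
  have hcorner := (toSet_subset_iff _ hCconvex).1 hR.1
  have hco : c = o := by
    rw [corner_ofCenter] at hcorner
    have k0 := hcorner 0
    have k1 := hcorner 1
    have k2 := hcorner 2
    have k3 := hcorner 3
    simp only [Matrix.cons_val] at k0 k1 k2 k3
    have := H.offset_eq_zero hD hneg (w := c - o) ha hb hab
      (by change _ ∈ C; convert k2 using 1; abel) (by change _ ∈ C; convert k1 using 1; abel)
      (by change _ ∈ C; convert k3 using 1; abel) (by change _ ∈ C; convert k0 using 1; abel)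
    exact sub_eq_zero.1 this
  subst hco
  have hP : a + b ∈ {x | c + x ∈ C} := by
    have := hcorner 2
    rwa [corner_ofCenter] at this
  have hQ : a - b ∈ {x | c + x ∈ C} := by
    have := hcorner 1
    rwa [corner_ofCenter] at this
  have hint_neg : ∀ x, c + x ∈ interior C → c + -x ∈ interior C := by
    intro x hx
    rw [← mem_interior_preimage_add] at hx ⊢
    have := (Homeomorph.neg Plane).preimage_interior {x | c + x ∈ C}
    have e : (Homeomorph.neg Plane) ⁻¹' {x | c + x ∈ C} = {x | c + x ∈ C} := by
      ext y
      exact ⟨fun h => by simpa using hneg _ h, fun h => hneg _ h⟩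
    rw [e] at this
    rw [← this] at hx
    exact hx
  have ho : c ∈ interior C := by
    have := mem_interior_of_abs_lt hD ha hb hab hP hQ
      (by convert hneg _ hQ using 1; abel) (by convert hneg _ hP using 1; abel)
      (s := 0) (t := 0) (by simp) (by simp)
    rw [mem_interior_preimage_add] at this
    simpa using this
  have hfr : ∀ x, c + x ∈ C → c + x ∉ interior C → c + x ∈ frontier C ∧ c + -x ∈ frontier C :=
    fun x hx hx' => ⟨⟨subset_closure hx, hx'⟩, subset_closure (hneg x hx),
      fun h => hx' (by simpa using hint_neg _ h)⟩
  have hopp : ∃ j k, ∃ x : Plane, (ofCenter c a b ha hb hab).corner j = c + x ∧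
      (ofCenter c a b ha hb hab).corner k = c + -x ∧ c + x ∈ C ∧ c + x ∉ interior C := by
    rw [corner_ofCenter]
    rcases H.exists_not_mem_interior ha hb hab with h | h <;> rw [mem_interior_preimage_add] at h
    · exact ⟨2, 0, a + b, rfl, rfl, hP, h⟩
    · exact ⟨1, 3, a - b, rfl, rfl, hQ, h⟩
  refine ⟨?_, ?_, ?_, ?_⟩
  · ext x
    simp only [Set.mem_inter_iff, SetLike.mem_coe, Set.mem_singleton_iff]
    refine ⟨fun ⟨hx1, hx2⟩ => ?_, ?_⟩
    · rw [hℓ₁] at hx1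
      rw [hℓ₂] at hx2
      rw [← sub_eq_zero, plane_expansion n₁0 n₂0 hn₁₂ (x - c), hx1, hx2]
      simp
    · rintro rfl
      exact ⟨hℓ₁.mem_self, hℓ₂.mem_self⟩
  · intro hne
    obtain ⟨j, k, z, hj, hk, hzC, hz⟩ := hopp
    have side : ∀ {ℓ : AffineSubspace ℝ Plane} {n : Plane}, HasNormal ℓ c n → ‖n‖ = 1 → c + z ∉ ℓ →
        ∀ x, x ∉ ℓ → ∃ k, ℓ.SSameSide x ((ofCenter c a b ha hb hab).corner k) ∧
          (ofCenter c a b ha hb hab).corner k ∈ frontier C := by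
      intro ℓ n hℓ hn hzℓ x hx
      rw [hℓ, add_sub_cancel_left] at hzℓ
      rw [hℓ] at hx
      -- The opposite corners `c + z` and `c - z` lie on different sides of `ℓ`, so one is on the
      -- side of `x`.
      rcases (mul_ne_zero hx hzℓ).lt_or_gt with h | h
      · refine ⟨k, ?_, hk ▸ (hfr z hzC hz).2⟩
        rw [hk, hℓ.sSameSide_iff hn, add_sub_cancel_left, inner_neg_right]
        linarith
      · refine ⟨j, ?_, hj ▸ (hfr z hzC hz).1⟩
        rw [hj, hℓ.sSameSide_iff hn, add_sub_cancel_left]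
        exact h
    refine ⟨side hℓ₁ hn₁ fun h => hne ⟨j, Or.inl ?_⟩, side hℓ₂ hn₂ fun h => hne ⟨j, Or.inr ?_⟩⟩
    · exact hj ▸ hℓ₁.mem_extremePoints n₁0 hCconvex ho h hzC hz
    · exact hj ▸ hℓ₂.mem_extremePoints n₂0 hCconvex ho h hzC hz
  · intro hsq
    rw [isSquare_ofCenter] at hsq
    refine ⟨?_, ?_⟩
    · have hPQ : ⟪a + b, a - b⟫_ℝ = 0 := by
        rw [inner_add_left, inner_sub_right, inner_sub_right, real_inner_comm a b, hab,
          real_inner_self_eq_norm_sq, real_inner_self_eq_norm_sq, hsq]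
        ring
      have hPP : ⟪a + b, a + b⟫_ℝ = ⟪a - b, a - b⟫_ℝ := by
        simp only [inner_add_left, inner_add_right, inner_sub_left, inner_sub_right,
          real_inner_comm a b, hab]
        ring
      have hpos : 0 < ⟪a + b, a + b⟫_ℝ := by
        simp only [inner_add_left, inner_add_right, real_inner_comm a b, hab,
          real_inner_self_eq_norm_sq]
        positivity
      have hdiag₁ : ∀ {ℓ : AffineSubspace ℝ Plane} {n : Plane}, HasNormal ℓ c n →
          ⟪n, a + b⟫_ℝ = 0 → (ofCenter c a b ha hb hab).diag₁ ⊆ symAxis ℓ C := by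
        intro ℓ n hℓ h
        refine Set.subset_inter (ℓ.convex.segment_subset ?_ ?_)
          (hCconvex.segment_subset (hcorner 0) (hcorner 2)) <;>
        · rw [corner_ofCenter, SetLike.mem_coe, hℓ]
          simp only [Matrix.cons_val, add_sub_cancel_left, inner_neg_right, h, neg_zero]
      have hdiag₂ : ∀ {ℓ : AffineSubspace ℝ Plane} {n : Plane}, HasNormal ℓ c n →
          ⟪n, a - b⟫_ℝ = 0 → (ofCenter c a b ha hb hab).diag₂ ⊆ symAxis ℓ C := by
        intro ℓ n hℓ h
        refine Set.subset_inter (ℓ.convex.segment_subset ?_ ?_)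
          (hCconvex.segment_subset (hcorner 1) (hcorner 3)) <;>
        · rw [corner_ofCenter, SetLike.mem_coe, hℓ]
          simp only [Matrix.cons_val, add_sub_cancel_left, inner_neg_right, h, neg_zero]
      rw [hcoord] at hPQ hpos
      rw [hcoord (a + b), hcoord (a - b)] at hPP
      by_cases hp : ⟪n₁, a + b⟫_ℝ = 0
      · rw [hp, zero_mul, zero_add] at hPQ hpos
        exact Or.inl (Or.inl ⟨hdiag₁ hℓ₁ hp, hdiag₂ hℓ₂
          ((mul_eq_zero.1 hPQ).resolve_left (mul_self_pos.1 hpos))⟩)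
      by_cases hq : ⟪n₂, a + b⟫_ℝ = 0
      · rw [hq, zero_mul, add_zero] at hPQ hpos
        exact Or.inl (Or.inr ⟨hdiag₁ hℓ₂ hq, hdiag₂ hℓ₁
          ((mul_eq_zero.1 hPQ).resolve_left (mul_self_pos.1 hpos))⟩)
      right
      intro x hx₁ hx₂
      rw [hℓ₁] at hx₁
      rw [hℓ₂] at hx₂
      have hmem : ∀ k, (ofCenter c a b ha hb hab).corner k ∈ openQuadrant ℓ₁ ℓ₂ x ↔
          0 < ⟪n₁, x - c⟫_ℝ *
            ![-⟪n₁, a + b⟫_ℝ, ⟪n₁, a - b⟫_ℝ, ⟪n₁, a + b⟫_ℝ, -⟪n₁, a - b⟫_ℝ] k ∧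
          0 < ⟪n₂, x - c⟫_ℝ *
            ![-⟪n₂, a + b⟫_ℝ, ⟪n₂, a - b⟫_ℝ, ⟪n₂, a + b⟫_ℝ, -⟪n₂, a - b⟫_ℝ] k := by
        intro k
        rw [openQuadrant, Set.mem_ofPred_eq, hℓ₁.sSameSide_iff hn₁, hℓ₂.sSameSide_iff hn₂,
          corner_ofCenter]
        fin_cases k <;>
          simp only [Fin.zero_eta, Fin.mk_one, Fin.reduceFinMk, Matrix.cons_val,
            add_sub_cancel_left, inner_neg_right]
      simp only [hmem]
      -- One half diagonal is the other turned by a right angle, in one of two senses.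
      rcases eq_turn_of_orthogonal hq hPQ hPP with ⟨e₁, e₂⟩ | ⟨e₁, e₂⟩ <;> rw [e₁, e₂]
      · simpa only [neg_neg] using existsUnique_same_signs hx₁ hx₂ hp hq
      · simpa only [neg_neg] using existsUnique_same_signs' hx₁ hx₂ hp hq
    · rw [corner_ofCenter]
      rcases H.exists_not_mem_interior ha hb hab with h | h <;> rw [mem_interior_preimage_add] at h
      · exact Or.inl (hfr _ hP h).symm
      · exact Or.inr (hfr _ hQ h)
  · have long : ∀ {ℓ : AffineSubspace ℝ Plane} {n : Plane}, HasNormal ℓ c n → ‖n‖ = 1 →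
        (∀ x ∈ {x | c + x ∈ C}, x - (2 * ⟪n, x⟫_ℝ) • n ∈ {x | c + x ∈ C}) →
        (∃ j, (ofCenter c a b ha hb hab).corner j ∈ ℓ) →
        (ofCenter c a b ha hb hab).IsSquare ∨ ∀ d ∈ ℓ.direction, d ≠ 0 →
          acuteAngle d (ofCenter c a b ha hb hab).longSide ∈
            Set.Ico (Real.pi / 6) (Real.pi / 4) := by
      rintro ℓ n hℓ hn hrefl ⟨j, hj⟩
      rw [isSquare_ofCenter, or_iff_not_imp_left]
      intro hne d hd hd0
      rw [hℓ.mem_direction] at hd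
      rw [acuteAngle_longSide_ofCenter]
      have hdiag : ⟪n, a + b⟫_ℝ = 0 ∨ ⟪n, a - b⟫_ℝ = 0 := by
        rw [corner_ofCenter, hℓ] at hj
        fin_cases j <;>
          simp only [Fin.zero_eta, Fin.mk_one, Fin.reduceFinMk, Matrix.cons_val,
            add_sub_cancel_left, inner_neg_right, neg_eq_zero] at hj
        exacts [Or.inl hj, Or.inr hj, Or.inl hj, Or.inr hj]
      split_ifs with hle
      · exact H.acuteAngle_mem_Ico_of_lt hneg hn hrefl ha hb hab hP hQ
          (lt_of_le_of_ne hle (Ne.symm hne)) hd0 hd hdiag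
      · have hQ' : b - a ∈ {x | c + x ∈ C} := by convert hneg _ hQ using 1; abel
        refine H.swap.acuteAngle_mem_Ico_of_lt hneg hn hrefl hb ha (by rwa [real_inner_comm])
          (by rwa [add_comm]) hQ' (not_le.1 hle) hd0 hd ?_
        rwa [add_comm b a, ← neg_sub a b, inner_neg_right, neg_eq_zero]
    rintro ℓ (rfl | rfl) ⟨j, k, -, hj, -⟩
    · exact long hℓ₁ hn₁ hrefl₁ ⟨j, hj.1⟩
    · exact long hℓ₂ hn₂ hrefl₂ ⟨j, hj.1⟩
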